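/- Let $q$ be a prime power and let $n,k,\ell$ be integers with $\ell\ge 0$ and $\ell+1\le k\le n-\ell-1$; set $a=k-\ell$ and $b=n-k-\ell$. Equip $\mathbb F_{q^2}^n$ with the Hermitian inner product $\langle x,y\rangle_H=\sum_{i=1}^n x_iy_i^q$. For a linear code (subspace) $C\subseteq\mathbb F_{q^2}^n$ let $C^{\perp_H}=\{y:\langle x,y\rangle_H=0\text{ for all }x\in C\}$ and $\mathrm{Hull}_H(C)=C\cap C^{\perp_H}$, and for integers $j\ge 0$ let $$A^H_{n,k,j,q}=\bigl|\{C\subseteq\mathbb F_{q^2}^n:\ \dim C=k,\ \dim\mathrm{Hull}_H(C)=j\}\bigr|.$$ Then $$A^H_{n,k,\ell,q}=\alpha^H_{n,k,\ell,q}\,(q^{\ell+1}-1)\,A^H_{n,k,\ell+1,q},\qquad\text{where}\qquad \alpha^H_{n,k,\ell,q}=\frac{q^{n-2\ell-1}(q^{\ell+1}+1)}{(q^a-(-1)^a)(q^b-(-1)^b)}.$$ Moreover, $\alpha^H_{n,k,\ell,q}>1$ except when $\ell=0$, both $a$ and $b$ are odd, and $\min(a,b)=1$ (equivalently, $\ell=0$,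 $n$ is even, and $k\in\{1,n-1\}$); in that exceptional case $$\alpha^H_{n,k,0,q}=\frac{q^{\max(a,b)}}{q^{\max(a,b)}+1}\in\Bigl[\tfrac{q}{q+1},\,1\Bigr).$$ In all cases $\alpha^H_{n,k,\ell,q}\ge \frac{q}{q+1}\ge\frac23$. -/

import Mathlib

/-- In a finite field with `q ^ 2` elements the map `x ↦ x ^ q` is additive. -/
theorem add_pow_of_card_eq_sq {K : Type*} [Field K] [Finite K] {q : ℕ}
    (hK : Nat.card K = q ^ 2) (x y : K) : (x + y) ^ q = x ^ q + y ^ q := by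
  have := Fintype.ofFinite K
  obtain ⟨p, hp⟩ := CharP.exists K
  obtain ⟨m, hpp, hm⟩ := FiniteField.card K p
  rw [Nat.card_eq_fintype_card, hm] at hK
  have hdvd : q ∣ p ^ (m : ℕ) := hK ▸ dvd_pow_self q two_ne_zero
  obtain ⟨j, -, rfl⟩ := (Nat.dvd_prime_pow hpp).1 hdvd
  have : Fact p.Prime := ⟨hpp⟩
  exact add_pow_char_pow x y p j

/-- The Hermitian inner product `⟨x, y⟩_H = ∑ i, x_i * y_i ^ q` on `K ^ n`
(meant for `K` the field with `q ^ 2` elements). -/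
def hermInner {K : Type*} [Field K] (q : ℕ) {n : ℕ} (x y : Fin n → K) : K :=
  ∑ i, x i * y i ^ q

/-- The Hermitian dual `{y | ∀ x ∈ C, ⟨x, y⟩_H = 0}` of a linear code `C` of length `n` over the
field `K` with `q ^ 2` elements. -/
def hermDual {K : Type*} [Field K] [Finite K] {q : ℕ} (hK : Nat.card K = q ^ 2) {n : ℕ}
    (C : Submodule K (Fin n → K)) : Submodule K (Fin n → K) where
  carrier := {y | ∀ x ∈ C, hermInner q x y = 0}
  add_mem' := by
    intro y z hy hz x hx
    have h1 : hermInner q x (y + z) = hermInner q x y + hermInner q x z := by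
      simp only [hermInner, Pi.add_apply, add_pow_of_card_eq_sq hK, mul_add,
        Finset.sum_add_distrib]
    rw [h1, hy x hx, hz x hx, add_zero]
  zero_mem' := by
    intro x _
    have hq : q ≠ 0 := by
      rintro rfl
      exact Nat.card_pos.ne' hK
    simp [hermInner, hq]
  smul_mem' := by
    intro c y hy x hx
    have h1 : hermInner q x (c • y) = c ^ q * hermInner q x y := by
      simp only [hermInner, Pi.smul_apply, smul_eq_mul, Finset.mul_sum, mul_pow]
      exact Finset.sum_congr rfl fun i _ => by ring
    rw [h1, hy x hx, mul_zero]

/-- The Hermitian hull `C ∩ C^{⊥_H}`. -/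
def hermHull {K : Type*} [Field K] [Finite K] {q : ℕ} (hK : Nat.card K = q ^ 2) {n : ℕ}
    (C : Submodule K (Fin n → K)) : Submodule K (Fin n → K) :=
  C ⊓ hermDual hK C

/-- `A^H_{n,k,ℓ,q}`: the number of `k`-dimensional linear codes of length `n` over the field `K`
with `q ^ 2` elements whose Hermitian hull has dimension `ℓ`. -/
noncomputable def hermCount {K : Type*} [Field K] [Finite K] {q : ℕ} (hK : Nat.card K = q ^ 2)
    (n k ℓ : ℕ) : ℕ :=
  Nat.card {C : Submodule K (Fin n → K) //
    Module.finrank K C = k ∧ Module.finrank K (hermHull hK C) = ℓ}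

/-- `α^H_{n,k,ℓ,q}`, with `a = k - ℓ` and `b = n - k - ℓ`. No subtraction in the exponents
truncates when `ℓ + 1 ≤ k` and `k + ℓ + 1 ≤ n`. -/
noncomputable def alphaH (n k ℓ q : ℕ) : ℝ :=
  (q : ℝ) ^ (n - 2 * ℓ - 1) * ((q : ℝ) ^ (ℓ + 1) + 1) /
    (((q : ℝ) ^ (k - ℓ) - (-1) ^ (k - ℓ)) * ((q : ℝ) ^ (n - k - ℓ) - (-1) ^ (n - k - ℓ)))

/-!
For a code `C` of dimension `k` with hull of dimension `ℓ`, the Hermitian form induced on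
`C / Hull C` is nondegenerate of rank `k - ℓ`, and the numbers of isotropic and anisotropic vectors of `C` depend
only on `k` and `ℓ`. They are computed in `isoCount_eq` and `anisoCount_eq` by splitting off
anisotropic vectors one at a time (`isoCount_sup`), using that every nonzero `c` with `c ^ q = c` is
the norm `t ^ (q + 1)` of exactly `q + 1` elements (`card_norm_fiber`).

Say that a code is of type `(k, ℓ)` if it has dimension `k` and hull dimension `ℓ`. Two double counts
relate both sides of the ratio decomposition to the number of codes `D` of type `(k - 1, ℓ)`.

* `hermCount_mul_anisoCount`: adjoining to `D` an anisotropic vector of `D^⊥` keeps the hull, and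
  every code of type `(k, ℓ)` arises in this way from each of its anisotropic vectors `v`, with
  `D = C ∩ v^⊥`.
* `hermCount_mul_isoCount`: adjoining to `D` an isotropic vector of `D^⊥` outside `D` enlarges the
  hull by that vector, and a code `C` of type `(k, ℓ + 1)` arises in this way from each nonzero `w` in
  its hull and each hyperplane of `C` avoiding `w`.

Since `D^⊥` has dimension `n - k + 1` and the same hull as `D`, all multiplicities are explicit.
Eliminating the number of codes `D` gives `hermCount_eq_mul`. The claims on the size of the factor
`alphaH` are elementary inequalities between powers of `q`; the decisive one is `denominator_lt`.
-/

section HermitianCodes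

variable {K : Type*} [Field K]

/-! ### Hyperplanes avoiding a vector -/

/-- A hyperplane of `V` avoiding `w` is the kernel of a unique functional `f` with `f w = 1`. -/
theorem card_compl_hyperplane_top {V : Type*} [AddCommGroup V] [Module K V] [Module.Finite K V]
    {w : V} (hw : w ≠ 0) :
    Nat.card {D : Submodule K V // D ⊔ Submodule.span K {w} = ⊤ ∧ w ∉ D} =
      Nat.card K ^ (Module.finrank K V - 1) := by
  obtain ⟨f₀, hf₀⟩ : ∃ f : Module.Dual K V, f w = 1 := by
    obtain ⟨g, hgw, -⟩ := Submodule.exists_le_ker_of_notMem (p := (⊥ : Submodule K V)) (v := w)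
      (by simpa using hw)
    exact ⟨(g w)⁻¹ • g, by simp [hgw]⟩
  have h1 : Nat.card {f : Module.Dual K V // f w = 1} =
      Nat.card (Submodule.span K {w}).dualAnnihilator := by
    refine Nat.card_congr ((Equiv.subRight f₀).subtypeEquiv fun f => ?_)
    rw [Submodule.mem_dualAnnihilator]
    constructor
    · intro hf x hx
      obtain ⟨c, rfl⟩ := Submodule.mem_span_singleton.1 hx
      simp [hf, hf₀]
    · intro h
      have := h w (Submodule.mem_span_singleton_self w)
      simpa [hf₀, sub_eq_zero] using this
  have h2 := Subspace.finrank_add_finrank_dualAnnihilator_eq (Submodule.span K {w})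
  rw [finrank_span_singleton hw] at h2
  rw [show Module.finrank K V - 1 = Module.finrank K (Submodule.span K {w}).dualAnnihilator by omega,
    ← Module.natCard_eq_pow_finrank (K := K) (V := (Submodule.span K {w}).dualAnnihilator), ← h1]
  have hker : ∀ f : {f : Module.Dual K V // f w = 1},
      LinearMap.ker f.1 ⊔ Submodule.span K {w} = ⊤ ∧ w ∉ LinearMap.ker f.1 := by
    refine fun f => ⟨eq_top_iff.2 fun x _ => ?_, ?_⟩
    · rw [← sub_add_cancel x (f.1 x • w)]
      refine Submodule.add_mem_sup ?_
        (Submodule.smul_mem _ _ (Submodule.mem_span_singleton_self w))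
      simp [f.2]
    · rw [LinearMap.mem_ker, f.2]
      exact one_ne_zero
  refine (Nat.card_congr (Equiv.ofBijective
    (fun f => ⟨LinearMap.ker f.1, hker f⟩) ⟨?_, ?_⟩)).symm
  · rintro ⟨f, hf⟩ ⟨g, hg⟩ h
    have h' : LinearMap.ker f = LinearMap.ker g := congrArg Subtype.val h
    refine Subtype.ext (LinearMap.ext fun x => ?_)
    have hx : x - f x • w ∈ LinearMap.ker f := by simp [hf]
    rw [h', LinearMap.mem_ker, map_sub, map_smul, hg, smul_eq_mul, mul_one, sub_eq_zero] at hx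
    exact hx.symm
  · rintro ⟨D, hD, hwD⟩
    obtain ⟨g, hgw, hg⟩ := Submodule.exists_le_ker_of_notMem hwD
    refine ⟨⟨(g w)⁻¹ • g, by simp [hgw]⟩, Subtype.ext ?_⟩
    ext x
    have hx : x ∈ D ⊔ Submodule.span K {w} := hD ▸ Submodule.mem_top
    obtain ⟨d, hd, z, hz, rfl⟩ := Submodule.mem_sup.1 hx
    obtain ⟨c, rfl⟩ := Submodule.mem_span_singleton.1 hz
    have hgd : g d = 0 := hg hd
    rw [D.add_mem_iff_right hd]
    by_cases hc : c = 0
    · simp [hc, hgd]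
    · rw [D.smul_mem_iff hc]
      simp [hgd, hgw, hc, hwD]

theorem card_compl_hyperplane {V : Type*} [AddCommGroup V] [Module K V] [Module.Finite K V]
    {C : Submodule K V} {w : V} (hw : w ≠ 0) (hwC : w ∈ C) :
    Nat.card {D : Submodule K V // D ⊔ Submodule.span K {w} = C ∧ w ∉ D} =
      Nat.card K ^ (Module.finrank K C - 1) := by
  have hw' : (⟨w, hwC⟩ : C) ≠ 0 := fun h => hw (congrArg Subtype.val h)
  rw [← card_compl_hyperplane_top hw']
  have hspan : (Submodule.span K {(⟨w, hwC⟩ : C)}).map C.subtype = Submodule.span K {w} := by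
    rw [Submodule.map_span, Set.image_singleton, Submodule.subtype_apply]
  have hmap : ∀ D : {D : Submodule K C // D ⊔ Submodule.span K {⟨w, hwC⟩} = ⊤ ∧ ⟨w, hwC⟩ ∉ D},
      D.1.map C.subtype ⊔ Submodule.span K {w} = C ∧ w ∉ D.1.map C.subtype := by
    refine fun D => ⟨?_, ?_⟩
    · rw [← hspan, ← Submodule.map_sup, D.2.1, Submodule.map_subtype_top]
    · rintro ⟨x, hx, hxw⟩
      obtain rfl : x = ⟨w, hwC⟩ := Subtype.ext hxw
      exact D.2.2 hx
  refine (Nat.card_congr (Equiv.ofBijective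
    (fun D => ⟨D.1.map C.subtype, hmap D⟩) ⟨?_, ?_⟩)).symm
  · intro D D' h
    exact Subtype.ext (Submodule.map_injective_of_injective C.injective_subtype
      (congrArg Subtype.val h))
  · rintro ⟨D, hD, hwD⟩
    have hle : D ≤ C := hD ▸ le_sup_left
    have hmap : (D.comap C.subtype).map C.subtype = D := by
      rw [Submodule.map_comap_subtype, inf_eq_right.2 hle]
    refine ⟨⟨D.comap C.subtype, ?_, hwD⟩, Subtype.ext hmap⟩
    apply Submodule.map_injective_of_injective C.injective_subtype
    rw [Submodule.map_sup, hmap, hspan, hD, Submodule.map_subtype_top]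

/-! ### The Hermitian form and the dual code -/

theorem hermInner_add_left (q : ℕ) {n : ℕ} (x y z : Fin n → K) :
    hermInner q (x + y) z = hermInner q x z + hermInner q y z := by
  simp only [hermInner, Pi.add_apply, add_mul, Finset.sum_add_distrib]

theorem hermInner_smul_left (q : ℕ) {n : ℕ} (c : K) (x y : Fin n → K) :
    hermInner q (c • x) y = c * hermInner q x y := by
  simp only [hermInner, Pi.smul_apply, smul_eq_mul, Finset.mul_sum, mul_assoc]

theorem hermInner_smul_right (q : ℕ) {n : ℕ} (c : K) (x y : Fin n → K) :
    hermInner q x (c • y) = c ^ q * hermInner q x y := by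
  simp only [hermInner, Pi.smul_apply, smul_eq_mul, Finset.mul_sum, mul_pow]
  exact Finset.sum_congr rfl fun i _ => by ring

theorem hermInner_sup_right {q n : ℕ} {D : Submodule K (Fin n → K)}
    {v y : Fin n → K} (hD : ∀ x ∈ D, hermInner q x y = 0) (hv : hermInner q v y = 0) :
    ∀ x ∈ D ⊔ Submodule.span K {v}, hermInner q x y = 0 := by
  intro x hx
  obtain ⟨d, hd, z, hz, rfl⟩ := Submodule.mem_sup.1 hx
  obtain ⟨c, rfl⟩ := Submodule.mem_span_singleton.1 hz
  rw [hermInner_add_left, hermInner_smul_left, hD d hd, hv, mul_zero, add_zero]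

theorem card_eq_sq_pow_finrank {q : ℕ} (hK : Nat.card K = q ^ 2) {V : Type*} [AddCommGroup V]
    [Module K V] [Module.Finite K V] : Nat.card V = (q ^ 2) ^ Module.finrank K V := by
  rw [Module.natCard_eq_pow_finrank (K := K), hK]

variable [Finite K] {q : ℕ}

theorem one_lt_of_card_eq_sq (hK : Nat.card K = q ^ 2) : 1 < q := by
  have h : 1 < q ^ 2 := hK ▸ Finite.one_lt_card
  by_contra hq
  interval_cases q <;> simp at h

/-- The involution `x ↦ x ^ q` of the field with `q ^ 2` elements. -/
def conjHom (hK : Nat.card K = q ^ 2) : K →+* K where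
  toFun x := x ^ q
  map_one' := one_pow q
  map_mul' x y := mul_pow x y q
  map_zero' := zero_pow (one_lt_of_card_eq_sq hK).ne_bot
  map_add' := add_pow_of_card_eq_sq hK

theorem pow_pow_of_card_eq_sq (hK : Nat.card K = q ^ 2) (x : K) : (x ^ q) ^ q = x := by
  have := Fintype.ofFinite K
  rw [← pow_mul, ← sq, ← hK, Nat.card_eq_fintype_card, FiniteField.pow_card]

/-- The map `x ↦ x ^ q` as a permutation; it is its own inverse. -/
def conjEquiv (hK : Nat.card K = q ^ 2) : K ≃ K where
  toFun x := x ^ q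
  invFun x := x ^ q
  left_inv := pow_pow_of_card_eq_sq hK
  right_inv := pow_pow_of_card_eq_sq hK

variable {n : ℕ}

theorem hermInner_add_right (hK : Nat.card K = q ^ 2) (x y z : Fin n → K) :
    hermInner q x (y + z) = hermInner q x y + hermInner q x z := by
  simp only [hermInner, Pi.add_apply, add_pow_of_card_eq_sq hK, mul_add, Finset.sum_add_distrib]

theorem hermInner_pow (hK : Nat.card K = q ^ 2) (x y : Fin n → K) :
    hermInner q x y ^ q = hermInner q y x := by
  have h := map_sum (conjHom hK) (fun i => x i * y i ^ q) Finset.univ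
  refine Eq.trans h (Finset.sum_congr rfl fun i _ => ?_)
  change (x i * y i ^ q) ^ q = _
  rw [mul_pow, pow_pow_of_card_eq_sq hK, mul_comm]

theorem hermInner_eq_zero_comm (hK : Nat.card K = q ^ 2) {x y : Fin n → K}
    (h : hermInner q x y = 0) : hermInner q y x = 0 := by
  rw [← hermInner_pow hK, h, zero_pow (one_lt_of_card_eq_sq hK).ne_bot]

/-- The Hermitian dual is the Euclidean dual with every coordinate conjugated, so it has
complementary dimension. -/
theorem finrank_add_finrank_hermDual (hK : Nat.card K = q ^ 2) (C : Submodule K (Fin n → K)) :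
    Module.finrank K C + Module.finrank K (hermDual hK C) = n := by
  let B : LinearMap.BilinForm K (Fin n → K) := Matrix.toBilin' 1
  have hB : B.Nondegenerate :=
    Matrix.nondegenerate_toBilin'_iff.2 (Matrix.nondegenerate_of_det_ne_zero (by simp))
  have hrk := LinearMap.BilinForm.finrank_orthogonal hB C
  rw [Module.finrank_fin_fun] at hrk
  have hle : Module.finrank K C ≤ n := by
    simpa using Submodule.finrank_le C
  have hcard : Nat.card (hermDual hK C) = Nat.card (B.orthogonal C) := by
    refine Nat.card_congr (Equiv.subtypeEquiv (Equiv.piCongrRight fun _ => conjEquiv hK) ?_)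
    intro y
    change (∀ x ∈ C, hermInner q x y = 0) ↔ ∀ x ∈ C, B x _ = 0
    refine forall₂_congr fun x _ => ?_
    rw [Matrix.toBilin'_apply']
    simp [hermInner, dotProduct, conjEquiv]
  rw [card_eq_sq_pow_finrank hK, card_eq_sq_pow_finrank hK] at hcard
  have := Nat.pow_right_injective
    (by nlinarith [one_lt_of_card_eq_sq hK] : 2 ≤ q ^ 2) hcard
  omega

theorem hermDual_hermDual (hK : Nat.card K = q ^ 2) (C : Submodule K (Fin n → K)) :
    hermDual hK (hermDual hK C) = C := by
  refine (Submodule.eq_of_le_of_finrank_eq (S₁ := C) ?_ ?_).symm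
  · exact fun x hx y hy => hermInner_eq_zero_comm hK (hy x hx)
  · have h1 := finrank_add_finrank_hermDual hK C
    have h2 := finrank_add_finrank_hermDual hK (hermDual hK C)
    omega

theorem hermHull_hermDual (hK : Nat.card K = q ^ 2) (C : Submodule K (Fin n → K)) :
    hermHull hK (hermDual hK C) = hermHull hK C := by
  rw [hermHull, hermHull, hermDual_hermDual, inf_comm]

/-! ### Adjoining a vector orthogonal to a code -/

theorem hermHull_sup_anisotropic (hK : Nat.card K = q ^ 2) {D : Submodule K (Fin n → K)}
    {v : Fin n → K} (hv : v ∈ hermDual hK D) (hvv : hermInner q v v ≠ 0) :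
    hermHull hK (D ⊔ Submodule.span K {v}) = hermHull hK D := by
  ext y
  constructor
  · rintro ⟨hy, hy'⟩
    obtain ⟨d, hd, z, hz, rfl⟩ := Submodule.mem_sup.1 hy
    obtain ⟨c, rfl⟩ := Submodule.mem_span_singleton.1 hz
    have h := hy' v (Submodule.mem_sup_right (Submodule.mem_span_singleton_self v))
    rw [hermInner_add_right hK, hermInner_smul_right, hermInner_eq_zero_comm hK (hv d hd),
      zero_add] at h
    have hc : c = 0 := eq_zero_of_pow_eq_zero ((mul_eq_zero.1 h).resolve_right hvv)
    subst hc
    rw [zero_smul, add_zero] at hy' ⊢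
    exact ⟨hd, fun x hx => hy' x (Submodule.mem_sup_left hx)⟩
  · rintro ⟨hy, hy'⟩
    exact ⟨Submodule.mem_sup_left hy,
      hermInner_sup_right hy' (hermInner_eq_zero_comm hK (hv y hy))⟩

theorem hermHull_sup_isotropic (hK : Nat.card K = q ^ 2) {D : Submodule K (Fin n → K)}
    {w : Fin n → K} (hw : w ∈ hermDual hK D) (hww : hermInner q w w = 0) :
    hermHull hK (D ⊔ Submodule.span K {w}) = hermHull hK D ⊔ Submodule.span K {w} := by
  have hwC : ∀ x ∈ D ⊔ Submodule.span K {w}, hermInner q x w = 0 := hermInner_sup_right hw hww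
  apply le_antisymm
  · rintro y ⟨hy, hy'⟩
    obtain ⟨d, hd, z, hz, rfl⟩ := Submodule.mem_sup.1 hy
    refine Submodule.add_mem_sup ⟨hd, fun x hx => ?_⟩ hz
    have h := hy' x (Submodule.mem_sup_left hx)
    obtain ⟨c, rfl⟩ := Submodule.mem_span_singleton.1 hz
    rwa [hermInner_add_right hK, hermInner_smul_right, hw x hx, mul_zero, add_zero] at h
  · refine sup_le ?_ ?_
    · rintro y ⟨hy, hy'⟩
      exact ⟨Submodule.mem_sup_left hy,
        hermInner_sup_right hy' (hermInner_eq_zero_comm hK (hw y hy))⟩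
    · rw [Submodule.span_singleton_le_iff_mem]
      exact ⟨Submodule.mem_sup_right (Submodule.mem_span_singleton_self w), hwC⟩

theorem notMem_of_anisotropic (hK : Nat.card K = q ^ 2) {D : Submodule K (Fin n → K)}
    {v : Fin n → K} (hv : v ∈ hermDual hK D) (hvv : hermInner q v v ≠ 0) : v ∉ D :=
  fun h => hvv (hv v h)

/-- The orthogonal complement of `v` inside `C`. -/
def orthIn (hK : Nat.card K = q ^ 2) (C : Submodule K (Fin n → K)) (v : Fin n → K) :
    Submodule K (Fin n → K) :=
  C ⊓ hermDual hK (Submodule.span K {v})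

theorem mem_orthIn (hK : Nat.card K = q ^ 2) {C : Submodule K (Fin n → K)} {v x : Fin n → K} :
    x ∈ orthIn hK C v ↔ x ∈ C ∧ hermInner q v x = 0 := by
  refine and_congr_right fun _ =>
    ⟨fun h => h v (Submodule.mem_span_singleton_self v), fun h y hy => ?_⟩
  obtain ⟨c, rfl⟩ := Submodule.mem_span_singleton.1 hy
  rw [hermInner_smul_left, h, mul_zero]

theorem mem_hermDual_orthIn (hK : Nat.card K = q ^ 2) (C : Submodule K (Fin n → K))
    (v : Fin n → K) : v ∈ hermDual hK (orthIn hK C v) :=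
  fun _ hx => hermInner_eq_zero_comm hK ((mem_orthIn hK).1 hx).2

theorem orthIn_sup (hK : Nat.card K = q ^ 2) {C : Submodule K (Fin n → K)} {v : Fin n → K}
    (hv : v ∈ C) (hvv : hermInner q v v ≠ 0) : orthIn hK C v ⊔ Submodule.span K {v} = C := by
  refine le_antisymm (sup_le inf_le_left ((Submodule.span_singleton_le_iff_mem v C).2 hv))
    fun x hx => ?_
  -- `c` makes `x - c • v` orthogonal to `v`
  let c : K := hermInner q x v / hermInner q v v
  have h : x = (x - c • v) + c • v := by abel
  rw [h]
  refine Submodule.add_mem_sup ((mem_orthIn hK).2 ⟨C.sub_mem hx (C.smul_mem c hv), ?_⟩)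
    (Submodule.smul_mem _ c (Submodule.mem_span_singleton_self v))
  apply hermInner_eq_zero_comm hK
  rw [sub_eq_add_neg, ← neg_smul, hermInner_add_left, hermInner_smul_left]
  simp only [c]
  field_simp
  ring

theorem sup_orthIn (hK : Nat.card K = q ^ 2) {D : Submodule K (Fin n → K)} {v : Fin n → K}
    (hv : v ∈ hermDual hK D) (hvv : hermInner q v v ≠ 0) :
    orthIn hK (D ⊔ Submodule.span K {v}) v = D := by
  ext x
  rw [mem_orthIn]
  constructor
  · rintro ⟨hx, h⟩
    obtain ⟨d, hd, z, hz, rfl⟩ := Submodule.mem_sup.1 hx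
    obtain ⟨c, rfl⟩ := Submodule.mem_span_singleton.1 hz
    rw [hermInner_add_right hK, hermInner_smul_right, hermInner_eq_zero_comm hK (hv d hd),
      zero_add] at h
    have hc : c = 0 := eq_zero_of_pow_eq_zero ((mul_eq_zero.1 h).resolve_right hvv)
    rwa [hc, zero_smul, add_zero]
  · exact fun hx => ⟨Submodule.mem_sup_left hx, hermInner_eq_zero_comm hK (hv x hx)⟩

/-! ### Counting isotropic vectors -/

/-- The norm `t ↦ t ^ (q + 1)` maps `Kˣ` onto the group of nonzero `c` with `c ^ q = c`, with kernel
of order `q + 1`: as `Kˣ` is cyclic of order `(q + 1) * (q - 1)`, the image and that group both have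
order `q - 1`. -/
theorem card_norm_fiber (hK : Nat.card K = q ^ 2) {c : K} (hc : c ≠ 0) (hcq : c ^ q = c) :
    Nat.card {t : K // t ^ (q + 1) = c} = q + 1 := by
  have hq := one_lt_of_card_eq_sq hK
  have hU : Nat.card Kˣ = (q + 1) * (q - 1) := by
    rw [Nat.card_units, hK]
    obtain ⟨m, rfl⟩ := Nat.exists_eq_add_of_lt hq
    simp only [show 1 + m + 1 - 1 = m + 1 by omega]
    rw [show (1 + m + 1) ^ 2 = (1 + m + 1 + 1) * (m + 1) + 1 by ring]
    omega
  have hker : Nat.card (powMonoidHom (q + 1) : Kˣ →* Kˣ).ker = q + 1 := by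
    rw [IsCyclic.card_powMonoidHom_ker, hU, Nat.gcd_mul_right_left]
  have hker' : Nat.card (powMonoidHom (q - 1) : Kˣ →* Kˣ).ker = q - 1 := by
    rw [IsCyclic.card_powMonoidHom_ker, hU, Nat.gcd_mul_left_left]
  have hran : Nat.card (powMonoidHom (q + 1) : Kˣ →* Kˣ).range = q - 1 := by
    rw [IsCyclic.card_powMonoidHom_range, hU, Nat.gcd_mul_right_left,
      Nat.mul_div_cancel_left _ (by omega)]
  have hle : (powMonoidHom (q + 1) : Kˣ →* Kˣ).range ≤ (powMonoidHom (q - 1) : Kˣ →* Kˣ).ker := by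
    rintro _ ⟨u, rfl⟩
    rw [MonoidHom.mem_ker, powMonoidHom_apply, powMonoidHom_apply, ← pow_mul, ← hU, pow_card_eq_one']
  have heq := Subgroup.eq_of_le_of_card_ge hle (by rw [hker', hran])
  have hmem : Units.mk0 c hc ∈ (powMonoidHom (q + 1) : Kˣ →* Kˣ).range := by
    rw [heq, MonoidHom.mem_ker, powMonoidHom_apply]
    ext
    simp only [Units.val_pow_eq_pow_val, Units.val_mk0, Units.val_one]
    apply mul_right_cancel₀ hc
    rw [← pow_succ, Nat.sub_add_cancel hq.le, hcq, one_mul]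
  obtain ⟨u, hu⟩ := hmem
  rw [powMonoidHom_apply] at hu
  have hu' : (u : K) ^ (q + 1) = c := by
    rw [← Units.val_pow_eq_pow_val, hu, Units.val_mk0]
  refine Eq.trans (Nat.card_congr (Equiv.ofBijective
    (fun g : (powMonoidHom (q + 1) : Kˣ →* Kˣ).ker =>
      (⟨(g.1 : K) * u, ?_⟩ : {t : K // t ^ (q + 1) = c})) ⟨?_, ?_⟩)).symm hker
  · have := g.2
    rw [MonoidHom.mem_ker, powMonoidHom_apply] at this
    rw [mul_pow, ← Units.val_pow_eq_pow_val, this, Units.val_one, one_mul, hu']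
  · intro g g' h
    have h' : (g.1 : K) * u = g'.1 * u := congrArg Subtype.val h
    exact Subtype.ext (Units.ext (mul_right_cancel₀ u.ne_zero h'))
  · rintro ⟨t, ht⟩
    have ht0 : t ≠ 0 := by
      rintro rfl
      rw [zero_pow (Nat.succ_ne_zero q)] at ht
      exact hc ht.symm
    refine ⟨⟨Units.mk0 t ht0 * u⁻¹, ?_⟩, Subtype.ext (by simp)⟩
    rw [MonoidHom.mem_ker, powMonoidHom_apply, mul_pow, inv_pow, hu, mul_inv_eq_one]
    ext
    simpa using ht

/-- A Hermitian form without anisotropic vectors vanishes. -/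
theorem exists_anisotropic (hK : Nat.card K = q ^ 2) {C : Submodule K (Fin n → K)}
    (hC : hermHull hK C ≠ C) : ∃ v ∈ C, hermInner q v v ≠ 0 := by
  by_contra! hiso
  refine hC (le_antisymm inf_le_left fun y hy => ⟨hy, fun x hx => ?_⟩)
  by_contra hxy
  have hq := one_lt_of_card_eq_sq hK
  -- polarization makes the trace `u + u ^ q` vanish identically
  have htr : ∀ u : K, u + u ^ q = 0 := by
    intro u
    obtain ⟨c, hc⟩ : ∃ c : K, c ^ q * hermInner q x y = u :=
      ⟨(u / hermInner q x y) ^ q, by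
        rw [pow_pow_of_card_eq_sq hK, div_mul_cancel₀ _ hxy]⟩
    have h := hiso (x + c • y) (C.add_mem hx (C.smul_mem c hy))
    rw [hermInner_add_left, hermInner_add_right hK, hermInner_add_right hK, hiso x hx,
      hermInner_smul_left, hermInner_smul_right, hermInner_smul_right, hermInner_smul_left,
      hiso y hy, hc, mul_zero, mul_zero, add_zero, zero_add, ← hermInner_pow hK x y] at h
    rw [← hc, mul_pow, pow_pow_of_card_eq_sq hK, hc]
    exact h
  have := Fintype.ofFinite K
  let P : Polynomial K := Polynomial.X + Polynomial.X ^ q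
  have hdeg : P.natDegree = q := by
    simp only [P]
    rw [Polynomial.natDegree_add_eq_right_of_natDegree_lt] <;> simp [hq]
  have hP : P = 0 := by
    apply Polynomial.eq_zero_of_natDegree_lt_card_of_eval_eq_zero' P Finset.univ
    · intro u _
      simpa [P] using htr u
    · rw [hdeg, Finset.card_univ, ← Nat.card_eq_fintype_card, hK]
      nlinarith
  rw [hP, Polynomial.natDegree_zero] at hdeg
  omega

/-- A two-step count: if every `a` with `p a` is related to exactly `c` elements `b`, the number
of related pairs is `c` times the number of such `a`. As `c` lives in a semiring, its value may be
given by a formula with no meaning in `ℕ` when there is no `a` with `p a`. -/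
theorem natCast_card_pairs {R α β : Type*} [Semiring R] [Finite α] [Finite β] {p : α → Prop}
    {r : α → β → Prop} {c : R} (h : ∀ a, p a → (Nat.card {b // r a b} : R) = c) :
    (Nat.card {x : α × β // p x.1 ∧ r x.1 x.2} : R) = Nat.card {a // p a} * c := by
  have := Fintype.ofFinite {a // p a}
  have e : {x : α × β // p x.1 ∧ r x.1 x.2} ≃ Σ a : {a // p a}, {b // r a.1 b} :=
    { toFun := fun x => ⟨⟨x.1.1, x.2.1⟩, ⟨x.1.2, x.2.2⟩⟩
      invFun := fun s => ⟨(s.1.1, s.2.1), s.1.2, s.2.2⟩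
      left_inv := fun _ => rfl
      right_inv := fun _ => rfl }
  rw [Nat.card_congr e, Nat.card_sigma, Nat.cast_sum, Finset.sum_congr rfl fun a _ => h a.1 a.2,
    Finset.sum_const, Finset.card_univ, nsmul_eq_mul, Nat.card_eq_fintype_card]

theorem card_pairs {α β : Type*} [Finite α] [Finite β] {p : α → Prop} {r : α → β → Prop} {c : ℕ}
    (h : ∀ a, p a → Nat.card {b // r a b} = c) :
    Nat.card {x : α × β // p x.1 ∧ r x.1 x.2} = Nat.card {a // p a} * c := by
  simpa only [Nat.cast_id] using natCast_card_pairs (R := ℕ) (p := p) (r := r) (c := c) h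

theorem card_subtype_add_card_subtype_not {α : Type*} [Finite α] (p r : α → Prop) :
    Nat.card {x // p x ∧ r x} + Nat.card {x // p x ∧ ¬ r x} = Nat.card {x // p x} := by
  classical
  have := Fintype.ofFinite α
  simp only [Nat.card_eq_fintype_card, Fintype.card_subtype]
  rw [← Finset.filter_filter, ← Finset.filter_filter, Finset.card_filter_add_card_filter_not]

/-- The number of isotropic vectors of a code, zero included. -/
noncomputable def isoCount (q : ℕ) (C : Submodule K (Fin n → K)) : ℕ :=
  Nat.card {x : Fin n → K // x ∈ C ∧ hermInner q x x = 0}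

/-- The number of anisotropic vectors of a code. -/
noncomputable def anisoCount (q : ℕ) (C : Submodule K (Fin n → K)) : ℕ :=
  Nat.card {x : Fin n → K // x ∈ C ∧ hermInner q x x ≠ 0}

theorem isoCount_add_anisoCount (hK : Nat.card K = q ^ 2) (C : Submodule K (Fin n → K)) :
    isoCount q C + anisoCount q C = (q ^ 2) ^ Module.finrank K C := by
  rw [isoCount, anisoCount, card_subtype_add_card_subtype_not, ← card_eq_sq_pow_finrank hK]

theorem hermInner_sup_self (hK : Nat.card K = q ^ 2) {D : Submodule K (Fin n → K)}
    {v d : Fin n → K} (hv : v ∈ hermDual hK D) (hd : d ∈ D) (t : K) :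
    hermInner q (d + t • v) (d + t • v) =
      hermInner q d d + t ^ (q + 1) * hermInner q v v := by
  rw [hermInner_add_left, hermInner_add_right hK, hermInner_add_right hK, hermInner_smul_left,
    hermInner_smul_right, hermInner_smul_right, hermInner_smul_left, hv d hd,
    hermInner_eq_zero_comm hK (hv d hd)]
  ring

/-- Isotropic vectors of `D ⟂ ⟨v⟩` are the sums `d + t v` with `t ^ (q + 1) = - ⟨d, d⟩ / ⟨v, v⟩`;
there is one such `t` if `d` is isotropic and there are `q + 1` of them otherwise. -/
theorem isoCount_sup (hK : Nat.card K = q ^ 2) {D : Submodule K (Fin n → K)}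
    {v : Fin n → K} (hv : v ∈ hermDual hK D) (hvv : hermInner q v v ≠ 0) :
    isoCount q (D ⊔ Submodule.span K {v}) = isoCount q D + (q + 1) * anisoCount q D := by
  have hq := one_lt_of_card_eq_sq hK
  let r : (Fin n → K) → K → Prop := fun d t => hermInner q d d + t ^ (q + 1) * hermInner q v v = 0
  have e : {x : (Fin n → K) × K // x.1 ∈ D ∧ r x.1 x.2} ≃
      {x : Fin n → K // x ∈ D ⊔ Submodule.span K {v} ∧ hermInner q x x = 0} := by
    refine Equiv.ofBijective (fun x => ⟨x.1.1 + x.1.2 • v,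
      Submodule.add_mem_sup x.2.1 (Submodule.smul_mem _ _ (Submodule.mem_span_singleton_self v)),
      ?_⟩) ⟨?_, ?_⟩
    · rw [hermInner_sup_self hK hv x.2.1]
      exact x.2.2
    · rintro ⟨⟨d, t⟩, hd, h1⟩ ⟨⟨d', t'⟩, hd', h2⟩ h
      have h' : d + t • v = d' + t' • v := congrArg Subtype.val h
      have hmem : (t - t') • v ∈ D := by
        rw [sub_smul, show t • v - t' • v = d' - d by
          rw [sub_eq_sub_iff_add_eq_add, add_comm, h', add_comm]]
        exact D.sub_mem hd' hd
      have htt : t = t' := by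
        by_contra hne
        exact notMem_of_anisotropic hK hv hvv
          ((D.smul_mem_iff (sub_ne_zero.2 hne)).1 hmem)
      subst htt
      have := add_right_cancel h'
      subst this
      rfl
    · rintro ⟨x, hx, hxx⟩
      obtain ⟨d, hd, z, hz, rfl⟩ := Submodule.mem_sup.1 hx
      obtain ⟨t, rfl⟩ := Submodule.mem_span_singleton.1 hz
      rw [hermInner_sup_self hK hv hd] at hxx
      exact ⟨⟨(d, t), hd, hxx⟩, rfl⟩
  rw [isoCount, ← Nat.card_congr e,
    ← card_subtype_add_card_subtype_not _ fun x => hermInner q x.1 x.1 = 0]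
  have e1 : Nat.card {x : (Fin n → K) × K // (x.1 ∈ D ∧ r x.1 x.2) ∧ hermInner q x.1 x.1 = 0} =
      isoCount q D * 1 := by
    rw [isoCount, ← card_pairs (α := Fin n → K) (β := K) (r := r)]
    · exact Nat.card_congr (Equiv.subtypeEquivRight fun x => by tauto)
    · rintro d ⟨hd, hdd⟩
      rw [Nat.card_eq_one_iff_unique]
      refine ⟨⟨?_⟩, ⟨⟨0, by simp [r, hdd]⟩⟩⟩
      rintro ⟨t, ht⟩ ⟨t', ht'⟩
      simp only [r, hdd, zero_add, mul_eq_zero, hvv, or_false] at ht ht'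
      rw [Subtype.mk.injEq, eq_zero_of_pow_eq_zero ht, eq_zero_of_pow_eq_zero ht']
  have e2 : Nat.card {x : (Fin n → K) × K // (x.1 ∈ D ∧ r x.1 x.2) ∧ ¬ hermInner q x.1 x.1 = 0} =
      anisoCount q D * (q + 1) := by
    rw [anisoCount, ← card_pairs (α := Fin n → K) (β := K) (r := r)]
    · exact Nat.card_congr (Equiv.subtypeEquivRight fun x => by tauto)
    · rintro d ⟨hd, hdd⟩
      have hc : -(hermInner q d d / hermInner q v v) ≠ 0 := neg_ne_zero.2 (div_ne_zero hdd hvv)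
      have hcq : (-(hermInner q d d / hermInner q v v)) ^ q =
          -(hermInner q d d / hermInner q v v) := by
        change conjHom hK _ = _
        rw [map_neg, map_div₀]
        change -(hermInner q d d ^ q / hermInner q v v ^ q) = _
        rw [hermInner_pow hK, hermInner_pow hK]
      rw [← card_norm_fiber hK hc hcq]
      refine Nat.card_congr (Equiv.subtypeEquivRight fun t => ?_)
      simp only [r]
      rw [← neg_div, eq_div_iff hvv, eq_neg_iff_add_eq_zero, add_comm]
  rw [e1, e2]
  ring

/-- The number of isotropic vectors of a code of dimension `k` whose Hermitian form has rank `r` is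
`q ^ (2 * k - 1) + (-1) ^ r * (q - 1) * q ^ (2 * k - 1 - r)`. The equation is multiplied by
`q ^ (r + 1)` to keep the exponents in `ℕ`. Induction on `r` splits off an anisotropic vector. -/
theorem isoCount_eq (hK : Nat.card K = q ^ 2) (r : ℕ) : ∀ (k : ℕ) (C : Submodule K (Fin n → K)),
    Module.finrank K C = k → Module.finrank K (hermHull hK C) + r = k →
    (q : ℝ) ^ (r + 1) * isoCount q C = ((q : ℝ) ^ 2) ^ k * ((q : ℝ) ^ r + (-1) ^ r * (q - 1)) := by
  induction r with
  | zero =>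
    intro k C hk hh
    have hC : hermHull hK C = C :=
      Submodule.eq_of_le_of_finrank_eq inf_le_left (by omega)
    have haniso : anisoCount q C = 0 := by
      have : IsEmpty {x : Fin n → K // x ∈ C ∧ hermInner q x x ≠ 0} := by
        refine ⟨fun ⟨x, hx, hxx⟩ => hxx ?_⟩
        rw [← hC] at hx
        exact hx.2 x hx.1
      exact Nat.card_of_isEmpty
    have h := isoCount_add_anisoCount hK C
    rw [haniso, add_zero, hk] at h
    rw [h]
    push_cast
    ring
  | succ r ih =>
    intro k C hk hh
    have hne : hermHull hK C ≠ C := by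
      intro h
      rw [h] at hh
      omega
    obtain ⟨v, hv, hvv⟩ := exists_anisotropic hK hne
    have hvD := mem_hermDual_orthIn hK C v
    have hsup := orthIn_sup hK hv hvv
    have hrk := Submodule.finrank_sup_span_singleton (notMem_of_anisotropic hK hvD hvv)
    have hhull := hermHull_sup_anisotropic hK hvD hvv
    have hcount := isoCount_sup hK hvD hvv
    rw [hsup] at hrk hhull hcount
    have hsum := isoCount_add_anisoCount hK (orthIn hK C v)
    have h := ih (k - 1) (orthIn hK C v) (by omega) (by rw [← hhull]; omega)
    obtain ⟨k, rfl⟩ : ∃ j, k = j + 1 := ⟨k - 1, by omega⟩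
    rw [show Module.finrank K (orthIn hK C v) = k by omega] at hsum
    rw [Nat.add_sub_cancel] at h
    rw [hcount]
    have hsum' : (isoCount q (orthIn hK C v) : ℝ) + anisoCount q (orthIn hK C v) =
        ((q : ℝ) ^ 2) ^ k := by exact_mod_cast hsum
    push_cast
    rw [← eq_sub_iff_add_eq'] at hsum'
    rw [hsum']
    linear_combination (-(q : ℝ) ^ 2) * h

theorem anisoCount_eq (hK : Nat.card K = q ^ 2) {r k : ℕ} {C : Submodule K (Fin n → K)}
    (hk : Module.finrank K C = k) (hh : Module.finrank K (hermHull hK C) + r = k) :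
    (q : ℝ) ^ (r + 1) * anisoCount q C =
      ((q : ℝ) ^ 2) ^ k * ((q - 1) * ((q : ℝ) ^ r - (-1) ^ r)) := by
  have h := isoCount_eq hK r k C hk hh
  have hsum : (isoCount q C : ℝ) + anisoCount q C = ((q : ℝ) ^ 2) ^ k := by
    exact_mod_cast hk ▸ isoCount_add_anisoCount hK C
  rw [← eq_sub_iff_add_eq'] at hsum
  rw [hsum]
  linear_combination -h

/-! ### Two double counts -/

/-- Splitting off an anisotropic vector: pairs `(C, v)` with `v ∈ C` anisotropic correspond to
pairs `(D, v)` with `v ∈ D^⊥` anisotropic, through `D = C ∩ v^⊥` and `C = D ⊔ ⟨v⟩`. -/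
theorem hermCount_mul_anisoCount (hK : Nat.card K = q ^ 2) {k ℓ : ℕ} {N M : ℝ}
    (hN : ∀ C : Submodule K (Fin n → K), Module.finrank K C = k + 1 →
      Module.finrank K (hermHull hK C) = ℓ → anisoCount q C = N)
    (hM : ∀ D : Submodule K (Fin n → K), Module.finrank K D = k →
      Module.finrank K (hermHull hK D) = ℓ → anisoCount q (hermDual hK D) = M) :
    hermCount hK n (k + 1) ℓ * N = hermCount hK n k ℓ * M := by
  rw [hermCount, hermCount, ← natCast_card_pairs (fun C hC => hN C hC.1 hC.2),
    ← natCast_card_pairs (fun D hD => hM D hD.1 hD.2)]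
  refine congrArg Nat.cast (Nat.card_congr ?_)
  refine
    { toFun := fun x => ⟨(orthIn hK x.1.1 x.1.2, x.1.2), ?_, ?_⟩
      invFun := fun x => ⟨(x.1.1 ⊔ Submodule.span K {x.1.2}, x.1.2), ?_, ?_⟩
      left_inv := ?_
      right_inv := ?_ }
  · obtain ⟨⟨C, v⟩, ⟨hk, hl⟩, hv, hvv⟩ := x
    have hvD := mem_hermDual_orthIn hK C v
    have hsup := orthIn_sup hK hv hvv
    have hrk := Submodule.finrank_sup_span_singleton (notMem_of_anisotropic hK hvD hvv)
    have hhull := hermHull_sup_anisotropic hK hvD hvv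
    rw [hsup] at hrk hhull
    exact ⟨Nat.succ.inj (hrk.symm.trans hk), hhull ▸ hl⟩
  · exact ⟨mem_hermDual_orthIn hK _ _, x.2.2.2⟩
  · obtain ⟨⟨D, v⟩, ⟨hk, hl⟩, hv, hvv⟩ := x
    refine ⟨?_, ?_⟩
    · rw [Submodule.finrank_sup_span_singleton (notMem_of_anisotropic hK hv hvv)]
      exact congrArg (· + 1) hk
    · rw [hermHull_sup_anisotropic hK hv hvv]
      exact hl
  · exact ⟨Submodule.mem_sup_right (Submodule.mem_span_singleton_self _), x.2.2.2⟩
  · rintro ⟨⟨C, v⟩, -, hv, hvv⟩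
    exact Subtype.ext (Prod.ext (orthIn_sup hK hv hvv) rfl)
  · rintro ⟨⟨D, v⟩, -, hv, hvv⟩
    exact Subtype.ext (Prod.ext (sup_orthIn hK hv hvv) rfl)

/-- Splitting off a vector of the hull: pairs `(D, w)` with `w ∈ D^⊥` isotropic and outside `D`
correspond to triples `(C, w, D)` with `w` in the hull of `C` and `D` a hyperplane of `C`
avoiding `w`, through `C = D ⊔ ⟨w⟩`. -/
theorem hermCount_mul_isoCount (hK : Nat.card K = q ^ 2) {k ℓ : ℕ} {N : ℝ}
    (hN : ∀ D : Submodule K (Fin n → K), Module.finrank K D = k →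
      Module.finrank K (hermHull hK D) = ℓ →
      isoCount q (hermDual hK D) = N) :
    hermCount hK n k ℓ * (N - ((q : ℝ) ^ 2) ^ ℓ) =
      hermCount hK n (k + 1) (ℓ + 1) *
        ((((q : ℝ) ^ 2) ^ (ℓ + 1) - 1) * ((q : ℝ) ^ 2) ^ k) := by
  have hsub : ∀ D : Submodule K (Fin n → K),
      (Module.finrank K D = k ∧ Module.finrank K (hermHull hK D) = ℓ) →
      Nat.card {w // (w ∈ hermDual hK D ∧ hermInner q w w = 0) ∧ w ∈ D} = (q ^ 2) ^ ℓ := by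
    rintro D ⟨-, hl⟩
    rw [← hl, ← card_eq_sq_pow_finrank hK]
    exact Nat.card_congr (Equiv.subtypeEquivRight fun w =>
      ⟨fun h => ⟨h.2, h.1.1⟩, fun h => ⟨⟨h.2, h.2 w h.1⟩, h.1⟩⟩)
  have hout : ∀ D : Submodule K (Fin n → K),
      (Module.finrank K D = k ∧ Module.finrank K (hermHull hK D) = ℓ) →
      (Nat.card {w // (w ∈ hermDual hK D ∧ hermInner q w w = 0) ∧ w ∉ D} : ℝ) =
        N - ((q : ℝ) ^ 2) ^ ℓ := by
    intro D hD
    have h := card_subtype_add_card_subtype_not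
      (fun w => w ∈ hermDual hK D ∧ hermInner q w w = 0) (fun w => w ∈ D)
    rw [hsub D hD] at h
    rw [← hN D hD.1 hD.2, isoCount, ← h]
    push_cast
    ring
  have hhull : ∀ C : Submodule K (Fin n → K),
      (Module.finrank K C = k + 1 ∧ Module.finrank K (hermHull hK C) = ℓ + 1) →
      (Nat.card {x : (Fin n → K) × Submodule K (Fin n → K) //
        (x.1 ∈ hermHull hK C ∧ x.1 ≠ 0) ∧ (x.2 ⊔ Submodule.span K {x.1} = C ∧ x.1 ∉ x.2)} : ℝ) =
      (((q : ℝ) ^ 2) ^ (ℓ + 1) - 1) * ((q : ℝ) ^ 2) ^ k := by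
    rintro C ⟨hk, hl⟩
    have hcompl := card_pairs (p := fun w : Fin n → K => w ∈ hermHull hK C ∧ w ≠ 0)
      (r := fun w (D : Submodule K (Fin n → K)) => D ⊔ Submodule.span K {w} = C ∧ w ∉ D)
      (c := (q ^ 2) ^ k) fun w hw => by
        rw [card_compl_hyperplane hw.2 hw.1.1, hK, hk, Nat.add_sub_cancel]
    rw [hcompl, Nat.cast_mul, Nat.cast_pow, Nat.cast_pow]
    congr 1
    have h := card_subtype_add_card_subtype_not (fun w => w ∈ hermHull hK C)
      (fun w : Fin n → K => w = 0)
    have h0 : Nat.card {w // w ∈ hermHull hK C ∧ w = 0} = 1 := by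
      rw [Nat.card_eq_one_iff_unique]
      exact ⟨⟨fun a b => Subtype.ext (a.2.2.trans b.2.2.symm)⟩, ⟨⟨0, zero_mem _, rfl⟩⟩⟩
    have hc := card_eq_sq_pow_finrank hK (V := hermHull hK C)
    rw [hl] at hc
    change Nat.card {w // w ∈ hermHull hK C} = _ at hc
    rw [hc, h0] at h
    rw [eq_sub_iff_add_eq']
    exact_mod_cast h
  rw [hermCount, hermCount, ← natCast_card_pairs hout, ← natCast_card_pairs hhull]
  refine congrArg Nat.cast (Nat.card_congr ?_)
  refine
    { toFun := fun x => ⟨(x.1.1 ⊔ Submodule.span K {x.1.2}, (x.1.2, x.1.1)), ?_, ?_⟩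
      invFun := fun x => ⟨(x.1.2.2, x.1.2.1), ?_, ?_⟩
      left_inv := fun _ => rfl
      right_inv := ?_ }
  · obtain ⟨⟨D, w⟩, ⟨hk, hl⟩, ⟨hw, hww⟩, hwD⟩ := x
    refine ⟨?_, ?_⟩
    · rw [Submodule.finrank_sup_span_singleton hwD]
      exact congrArg (· + 1) hk
    · rw [hermHull_sup_isotropic hK hw hww,
        Submodule.finrank_sup_span_singleton fun h : w ∈ hermHull hK D => hwD h.1]
      exact congrArg (· + 1) hl
  · obtain ⟨⟨D, w⟩, -, ⟨hw, hww⟩, hwD⟩ := x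
    refine ⟨⟨⟨Submodule.mem_sup_right (Submodule.mem_span_singleton_self _),
      hermInner_sup_right hw hww⟩, ?_⟩, rfl, hwD⟩
    rintro rfl
    exact hwD (zero_mem D)
  · obtain ⟨⟨C, w, D⟩, ⟨hk, hl⟩, ⟨hw, -⟩, hC, hwD⟩ := x
    change Module.finrank K C = k + 1 at hk
    change Module.finrank K (hermHull hK C) = ℓ + 1 at hl
    change w ∈ hermHull hK C at hw
    change Module.finrank K D = k ∧ Module.finrank K (hermHull hK D) = ℓ
    change D ⊔ Submodule.span K {w} = C at hC
    change w ∉ D at hwD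
    rw [← hC] at hk hl hw
    have hwdual : w ∈ hermDual hK D := fun x hx => hw.2 x (Submodule.mem_sup_left hx)
    have hww : hermInner q w w = 0 := hw.2 w hw.1
    rw [hermHull_sup_isotropic hK hwdual hww,
      Submodule.finrank_sup_span_singleton fun h : w ∈ hermHull hK D => hwD h.1] at hl
    rw [Submodule.finrank_sup_span_singleton hwD] at hk
    omega
  · obtain ⟨⟨C, w, D⟩, -, ⟨hw, -⟩, hC, hwD⟩ := x
    change w ∈ hermHull hK C at hw
    change D ⊔ Submodule.span K {w} = C at hC
    rw [← hC] at hw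
    exact ⟨⟨fun x hx => hw.2 x (Submodule.mem_sup_left hx), hw.2 w hw.1⟩, hwD⟩
  · rintro ⟨⟨C, w, D⟩, -, -, hC, -⟩
    exact Subtype.ext (Prod.ext hC rfl)

/-! ### The ratio factor -/

theorem one_le_pow_sub_neg_one_pow {x : ℝ} (hx : 2 ≤ x) {m : ℕ} (hm : 1 ≤ m) :
    1 ≤ x ^ m - (-1) ^ m := by
  have h : x ≤ x ^ m := le_self_pow₀ (by linarith) (by omega)
  rcases neg_one_pow_eq_or ℝ m with h' | h' <;> rw [h'] <;> linarith

theorem alphaH_eq_div {q n k ℓ a b : ℕ} (hℓk : ℓ + 1 ≤ k) (hkn : k + ℓ + 1 ≤ n)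
    (ha : a = k - ℓ) (hb : b = n - k - ℓ) :
    alphaH n k ℓ q = (q : ℝ) ^ (a + b - 1) * ((q : ℝ) ^ (ℓ + 1) + 1) /
      (((q : ℝ) ^ a - (-1) ^ a) * ((q : ℝ) ^ b - (-1) ^ b)) := by
  rw [alphaH, ← ha, ← hb, show n - 2 * ℓ - 1 = a + b - 1 by omega]

/-- The inequality behind `1 < alphaH`, with denominators cleared and one factor `t = q` moved to the
left to avoid the exponent `a + b - 1`. -/
theorem denominator_lt {t : ℝ} (ht : 2 ≤ t) {a b ℓ : ℕ} (ha : 1 ≤ a) (hb : 1 ≤ b)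
    (h : ¬ (ℓ = 0 ∧ Odd a ∧ Odd b ∧ min a b = 1)) :
    t * ((t ^ a - (-1) ^ a) * (t ^ b - (-1) ^ b)) < t ^ a * t ^ b * (t ^ (ℓ + 1) + 1) := by
  have hx : t ≤ t ^ a := le_self_pow₀ (by linarith) (by omega)
  have hy : t ≤ t ^ b := le_self_pow₀ (by linarith) (by omega)
  have hz : t ≤ t ^ (ℓ + 1) := le_self_pow₀ (by linarith) (by omega)
  have hxy : 0 < t ^ a * t ^ b := by positivity
  -- the case `ℓ = 0` bounds the others, which suffices unless `a` and `b` are both odd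
  have hmono : t ^ a * t ^ b * (t + 1) ≤ t ^ a * t ^ b * (t ^ (ℓ + 1) + 1) := by gcongr
  rcases Nat.even_or_odd a with hae | hao <;> rcases Nat.even_or_odd b with hbe | hbo
  · rw [hae.neg_one_pow, hbe.neg_one_pow]
    nlinarith
  · rw [hae.neg_one_pow, hbo.neg_one_pow]
    nlinarith
  · rw [hao.neg_one_pow, hbe.neg_one_pow]
    nlinarith
  · rw [hao.neg_one_pow, hbo.neg_one_pow]
    generalize hX : t ^ a = x at *
    generalize hY : t ^ b = y at *
    by_cases hℓ : ℓ = 0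
    · have hab : 3 ≤ a ∧ 3 ≤ b := by
        obtain ⟨i, rfl⟩ := hao
        obtain ⟨j, rfl⟩ := hbo
        have : min (2 * i + 1) (2 * j + 1) ≠ 1 := fun hm => h ⟨hℓ, ⟨i, rfl⟩, ⟨j, rfl⟩, hm⟩
        omega
      have hx3 : t ^ 3 ≤ x := hX ▸ pow_le_pow_right₀ (by linarith) hab.1
      have hy3 : t ^ 3 ≤ y := hY ▸ pow_le_pow_right₀ (by linarith) hab.2
      have ht3 : 4 * t ≤ t ^ 3 := by nlinarith [sq_nonneg t]
      have h1 : 4 * t * y ≤ x * y := by nlinarith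
      have h2 : 4 * t * x ≤ x * y := by nlinarith
      nlinarith
    · have hz2 : t ^ 2 ≤ t ^ (ℓ + 1) := pow_le_pow_right₀ (by linarith) (by omega)
      have hz3 : x * y * (t ^ 2 + 1) ≤ x * y * (t ^ (ℓ + 1) + 1) := by gcongr
      have h1 : t * y ≤ x * y := by nlinarith
      have h2 : t * x ≤ x * y := by nlinarith
      have h3 : t * t ≤ x * y := by nlinarith
      have h4 : 2 * t * (x * y) ≤ t ^ 2 * (x * y) := by
        rw [sq]
        gcongr
      nlinarith

theorem one_lt_alphaH {q n k ℓ a b : ℕ} (hq : 2 ≤ q) (hℓk : ℓ + 1 ≤ k) (hkn : k + ℓ + 1 ≤ n)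
    (ha : a = k - ℓ) (hb : b = n - k - ℓ)
    (h : ¬ (ℓ = 0 ∧ Odd a ∧ Odd b ∧ min a b = 1)) : 1 < alphaH n k ℓ q := by
  have hq' : (2 : ℝ) ≤ q := by exact_mod_cast hq
  have ha1 : 1 ≤ a := by omega
  have hb1 : 1 ≤ b := by omega
  have hA := one_le_pow_sub_neg_one_pow hq' ha1
  have hB := one_le_pow_sub_neg_one_pow hq' hb1
  rw [alphaH_eq_div hℓk hkn ha hb, one_lt_div (by positivity)]
  have hlt := denominator_lt hq' ha1 hb1 h
  refine lt_of_mul_lt_mul_left (hlt.trans_eq ?_) (by linarith : (0 : ℝ) ≤ q)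
  rw [← mul_assoc, ← pow_succ', Nat.sub_add_cancel (by omega), pow_add (q : ℝ) a b]

theorem alphaH_exceptional {q n k ℓ a b : ℕ} (hq : 2 ≤ q) (hℓk : ℓ + 1 ≤ k)
    (hkn : k + ℓ + 1 ≤ n) (ha : a = k - ℓ) (hb : b = n - k - ℓ)
    (h : ℓ = 0 ∧ Odd a ∧ Odd b ∧ min a b = 1) :
    alphaH n k ℓ q = (q : ℝ) ^ max a b / ((q : ℝ) ^ max a b + 1) := by
  rw [alphaH_eq_div hℓk hkn ha hb]
  obtain ⟨rfl, hao, hbo, hm⟩ := h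
  rw [hao.neg_one_pow, hbo.neg_one_pow, sub_neg_eq_add, sub_neg_eq_add]
  have hq0 : (0 : ℝ) ≤ q := Nat.cast_nonneg q
  rcases min_choice a b with hc | hc
  · obtain rfl : a = 1 := hc ▸ hm
    rw [max_eq_right (by omega), Nat.add_sub_cancel_left, zero_add, pow_one]
    field_simp
  · obtain rfl : b = 1 := hc ▸ hm
    rw [max_eq_left (by omega), Nat.add_sub_cancel, zero_add, pow_one]
    field_simp

theorem div_add_one_le_div_add_one {s t : ℝ} (hs : 0 < s) (hst : s ≤ t) :
    s / (s + 1) ≤ t / (t + 1) := by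
  rw [div_le_div_iff₀ (by linarith) (by linarith)]
  nlinarith

/-! ### The ratio of consecutive hull counts -/

/-- Codes of type `(k, ℓ)` and of type `(k, ℓ + 1)` are both compared with codes of type
`(k - 1, ℓ)`, by `hermCount_mul_anisoCount` and `hermCount_mul_isoCount`. The factors divided by
never vanish in the given range, so the count of codes of type `(k - 1, ℓ)` is eliminated. -/
theorem hermCount_eq_mul {q : ℕ} (hK : Nat.card K = q ^ 2) {n k ℓ : ℕ} (hℓk : ℓ + 1 ≤ k)
    (hkn : k + ℓ + 1 ≤ n) :
    (hermCount hK n k ℓ : ℝ) =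
      alphaH n k ℓ q * ((q : ℝ) ^ (ℓ + 1) - 1) * (hermCount hK n k (ℓ + 1) : ℝ) := by
  have hq : (2 : ℝ) ≤ q := by exact_mod_cast one_lt_of_card_eq_sq hK
  have hq0 : (0 : ℝ) < q := by linarith
  -- the ranks of codes of types `(k, ℓ)` and `(n - k, ℓ)` are `i + 1` and `j + 1`
  obtain ⟨i, rfl⟩ : ∃ i, k = ℓ + i + 1 := ⟨k - ℓ - 1, by omega⟩
  obtain ⟨j, rfl⟩ : ∃ j, n = ℓ + i + 1 + ℓ + j + 1 := ⟨n - (ℓ + i + 1) - ℓ - 1, by omega⟩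
  rw [alphaH_eq_div hℓk hkn (a := i + 1) (b := j + 1) (by omega) (by omega)]
  have hA := one_le_pow_sub_neg_one_pow hq (m := i + 1) (by omega)
  have hB := one_le_pow_sub_neg_one_pow hq (m := j + 1) (by omega)
  have hdual : ∀ D : Submodule K (Fin (ℓ + i + 1 + ℓ + j + 1) → K), Module.finrank K D = ℓ + i →
      Module.finrank K (hermDual hK D) = ℓ + j + 2 := by
    intro D hD
    have := finrank_add_finrank_hermDual hK D
    omega
  have h1 := hermCount_mul_anisoCount hK (n := ℓ + i + 1 + ℓ + j + 1) (k := ℓ + i) (ℓ := ℓ)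
    (N := ((q : ℝ) ^ 2) ^ (ℓ + i + 1) * ((q - 1) * ((q : ℝ) ^ (i + 1) - (-1) ^ (i + 1))) /
      (q : ℝ) ^ (i + 1 + 1))
    (M := ((q : ℝ) ^ 2) ^ (ℓ + j + 2) * ((q - 1) * ((q : ℝ) ^ (j + 2) - (-1) ^ (j + 2))) /
      (q : ℝ) ^ (j + 2 + 1))
    (fun C hC hl => by
      rw [eq_div_iff (by positivity), mul_comm]
      exact anisoCount_eq hK hC (by omega))
    (fun D hD hl => by
      rw [eq_div_iff (by positivity), mul_comm]
      exact anisoCount_eq hK (hdual D hD) (by rw [hermHull_hermDual]; omega))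
  have h2 := hermCount_mul_isoCount hK (n := ℓ + i + 1 + ℓ + j + 1) (k := ℓ + i) (ℓ := ℓ)
    (N := ((q : ℝ) ^ 2) ^ (ℓ + j + 2) * ((q : ℝ) ^ (j + 2) + (-1) ^ (j + 2) * (q - 1)) /
      (q : ℝ) ^ (j + 2 + 1))
    (fun D hD hl => by
      rw [eq_div_iff (by positivity), mul_comm]
      exact isoCount_eq hK _ _ _ (hdual D hD) (by rw [hermHull_hermDual]; omega))
  generalize (hermCount hK (ℓ + i + 1 + ℓ + j + 1) (ℓ + i + 1) ℓ : ℝ) = A at *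
  generalize (hermCount hK (ℓ + i + 1 + ℓ + j + 1) (ℓ + i + 1) (ℓ + 1) : ℝ) = A' at *
  generalize (hermCount hK (ℓ + i + 1 + ℓ + j + 1) (ℓ + i) ℓ : ℝ) = B at *
  have hf : ((-1 : ℝ) ^ j) ^ 2 = 1 := by rw [← pow_mul, mul_comm, pow_mul]; simp
  rw [show i + 1 + (j + 1) - 1 = i + j + 1 by omega]
  have hsq : ∀ m : ℕ, ((q : ℝ) ^ 2) ^ m = (q : ℝ) ^ m * (q : ℝ) ^ m := fun m => by
    rw [← mul_pow, sq]
  simp only [hsq] at h1 h2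
  simp only [pow_add, pow_succ, pow_zero, one_mul, mul_neg, mul_one, neg_neg, sub_neg_eq_add]
    at h1 h2 hA hB hf ⊢
  have hX : (0 : ℝ) < (q : ℝ) ^ i := by positivity
  have hY : (0 : ℝ) < (q : ℝ) ^ j := by positivity
  have hZ : (0 : ℝ) < (q : ℝ) ^ ℓ := by positivity
  generalize (q : ℝ) ^ i = X at *
  generalize (q : ℝ) ^ j = Y at *
  generalize (q : ℝ) ^ ℓ = Z at *
  generalize (-1 : ℝ) ^ i = e at *
  generalize (-1 : ℝ) ^ j = f at *
  generalize (q : ℝ) = t at *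
  -- writing `q = t`, cancel the positive powers of `q` that the two double counts share
  have h1' : A * (X * (X * t + e)) = B * (t * Y * (Y * t * t - f)) := by
    have hc : Z * Z * (t - 1) ≠ 0 := by
      have : t - 1 ≠ 0 := by linarith
      positivity
    apply mul_left_cancel₀ hc
    convert h1 using 1 <;> field_simp
  have h2' : B * ((Y * t * t - f) * (Y * t + f)) = A' * ((Z * t + 1) * (Z * t - 1) * (X * X)) := by
    apply mul_left_cancel₀ (mul_pos hZ hZ).ne'
    -- the isotropic vectors outside the radical: `f ^ 2 = 1` factors the count
    rw [show Z * Y * t * t * (Z * Y * t * t) * (Y * t * t + f * (t - 1)) / (Y * t * t * t) =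
      Z * Z * (t * Y * (Y * t * t + f * (t - 1))) by field_simp] at h2
    linear_combination h2 - B * Z ^ 2 * hf
  have hD : (X * t + e) * (Y * t + f) ≠ 0 := by positivity
  rw [div_mul_eq_mul_div, div_mul_eq_mul_div, eq_div_iff hD]
  apply mul_left_cancel₀ hX.ne'
  linear_combination (Y * t + f) * h1' + t * Y * h2'

end HermitianCodes

theorem theorem3p2 {K : Type*} [Field K] [Finite K] (q : ℕ) (hq : IsPrimePow q)
    (hK : Nat.card K = q ^ 2) (n k ℓ a b : ℕ) (hℓk : ℓ + 1 ≤ k) (hkn : k + ℓ + 1 ≤ n)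
    (ha : a = k - ℓ) (hb : b = n - k - ℓ) :
    -- the ratio decomposition
    (hermCount hK n k ℓ : ℝ) =
        alphaH n k ℓ q * ((q : ℝ) ^ (ℓ + 1) - 1) * (hermCount hK n k (ℓ + 1) : ℝ) ∧
    -- the closed form of the ratio factor
    alphaH n k ℓ q =
        (q : ℝ) ^ (n - 2 * ℓ - 1) * ((q : ℝ) ^ (ℓ + 1) + 1) /
          (((q : ℝ) ^ a - (-1) ^ a) * ((q : ℝ) ^ b - (-1) ^ b)) ∧
    -- the two descriptions of the exceptional case
    ((ℓ = 0 ∧ Odd a ∧ Odd b ∧ min a b = 1) ↔ (ℓ = 0 ∧ Even n ∧ (k = 1 ∨ k = n - 1))) ∧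
    -- outside the exceptional case
    (¬ (ℓ = 0 ∧ Odd a ∧ Odd b ∧ min a b = 1) → 1 < alphaH n k ℓ q) ∧
    -- in the exceptional case
    ((ℓ = 0 ∧ Odd a ∧ Odd b ∧ min a b = 1) →
        alphaH n k ℓ q = (q : ℝ) ^ max a b / ((q : ℝ) ^ max a b + 1) ∧
        (q : ℝ) / ((q : ℝ) + 1) ≤ alphaH n k ℓ q ∧ alphaH n k ℓ q < 1) ∧
    -- the uniform lower bound
    (q : ℝ) / ((q : ℝ) + 1) ≤ alphaH n k ℓ q ∧ (2 : ℝ) / 3 ≤ (q : ℝ) / ((q : ℝ) + 1) := by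
  have hq2 : 2 ≤ q := hq.two_le
  have hq' : (2 : ℝ) ≤ q := by exact_mod_cast hq2
  have hgt := one_lt_alphaH hq2 hℓk hkn ha hb
  have hex := alphaH_exceptional hq2 hℓk hkn ha hb
  have hmax : (q : ℝ) ≤ (q : ℝ) ^ max a b := le_self_pow₀ (by linarith) (by omega)
  have hlow := div_add_one_le_div_add_one (by linarith : (0 : ℝ) < q) hmax
  refine ⟨hermCount_eq_mul hK hℓk hkn, by rw [alphaH, ha, hb], ?_, hgt, fun h => ⟨hex h, ?_, ?_⟩,
    ?_, ?_⟩
  · refine and_congr_right fun hℓ => ?_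
    subst hℓ
    simp only [Nat.odd_iff, Nat.even_iff]
    omega
  · rwa [hex h]
  · rw [hex h, div_lt_one (by linarith)]
    linarith
  · by_cases h : ℓ = 0 ∧ Odd a ∧ Odd b ∧ min a b = 1
    · rwa [hex h]
    · refine le_trans ?_ (hgt h).le
      rw [div_le_one (by linarith)]
      linarith
  · rw [div_le_div_iff₀ (by norm_num) (by linarith)]
    linarith
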